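/- **Setting.** Let $(M,g)$ be a smooth compact Riemannian manifold with boundary, of dimension $n\ge 1$. Let $A\subset M$ be a closed set with $A=\overline{\operatorname{int}A}$ and $A\cap\partial M\neq\emptyset$, whose boundary $\partial A$ (interior and boundary are taken in the topology of $M$) is $C^1$ and meets $\partial M$ orthogonally: every $x\in\partial A$ has a neighbourhood $U$ in $M$ and a $C^1$ function $\rho:U\to\mathbb R$ with $A\cap U=\{\rho\ge 0\}$, $\rho(x)=0$, $d\rho_x\ne0$, and $d\rho_x(\nu)=0$ for the normals $\nu$ of $\partial M$ if $x\in\partial M$. Put $$R=\partial M\cap\operatorname{int}A,\qquad E=\partial A\setminus\partial M,\qquad C=\partial A\cap\partial M .$$ **The double.** $\tilde A$ is the quotient of two disjoint copies of $A$ in which the two copies of each point of $\bar R$ are identified; $\pi:\tilde A\to A$ is the natural projection, and $\tilde f=f\circ\pi$ for $f:A\to\mathbb R$. Its boundary is $\pi^{-1}(E\cup C)$. Its differentiable structure is given off $\pi^{-1}(\partial M)$ by that of $M$, and at points of $\pi^{-1}(\partial M)$ by boundary normal coordinates of $M$ in which the sign of the normal coordinate is changed on the second copy; it carries the metric $\tilde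 g=\pi^*g$, which is smooth up to $\pi^{-1}(\partial M)$ on each copy. $\Gamma(\tilde A)$ is the set of unit speed geodesics $\varphi:[0,L]\to\tilde A$, $L>0$, with $\varphi(0),\varphi(L)\in\partial\tilde A$. Here a geodesic is a $C^1$ curve such that each time has a one-sided neighbourhood, on the left and on the right, during which the curve stays in one copy of $A$ and satisfies the geodesic equation there. **Broken rays.** $\Gamma_E(A)$ is the set of unit speed, piecewise geodesic curves $\gamma:[0,L]\to A$, $L>0$ (finitely many pieces, each satisfying the geodesic equation of $M$), with $\gamma(0),\gamma(L)\in E\cup C$, such that at each time $t\in(0,L)$ the velocity is continuous if $\gamma(t)\notin\partial M\cup\partial A$, and otherwise is reflected by the law that the angle of incidence equals the angle of reflection: in the hyperplane $T\partial M$ if $\gamma(t)\in R$, in $T\partial A$ if $\gamma(t)\in E$, and in both if $\gamma(t)\in C$. **Transforms.** For $h,f:\tilde A\to\mathbb R$ and $\varphi\in\Gamma(\tilde A)$, respectively $h,f:A\to\mathbb R$ and $\gamma\in\Gamma_E(A)$, put $$I_hf(\varphi)=\int_0^L f(\varphi(t))\,e^{\int_0^t h(\varphi(s))\,ds}\,dt,\qquad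 G_hf(\gamma)=\int_0^L f(\gamma(t))\,e^{\int_0^t h(\gamma(s))\,ds}\,dt$$ (an integral that does not exist is given the value $0$). **Theorem.** Let $F$ and $H$ be any classes of functions $A\to\mathbb R$, and let $\tilde F=\{\tilde f: f\in F\}$, $\tilde H=\{\tilde h:h\in H\}$. 1. (Unknown attenuation.) If the map $(\tilde h,\tilde f)\mapsto I_{\tilde h}\tilde f\in\mathbb R^{\Gamma(\tilde A)}$ is injective on $\tilde H\times\tilde F$, then the map $(h,f)\mapsto G_hf\in\mathbb R^{\Gamma_E(A)}$ is injective on $H\times F$. 2. (Known attenuation.) For each $h\in H$: if $\tilde f\mapsto I_{\tilde h}\tilde f$ is injective on $\tilde F$, then $f\mapsto G_hf$ is injective on $F$. -/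

import Mathlib

open Set Filter Topology MeasureTheory Bundle
open scoped Manifold ContDiff

noncomputable section

namespace BrokenRay

/-- The coordinate space `ℝⁿ`; coordinate `0` is the one that is nonnegative in the half space
on which a manifold with boundary is modelled. -/
abbrev Coord (n : ℕ) : Type := EuclideanSpace ℝ (Fin n)

/-- A smooth Riemannian metric on an `n`-dimensional manifold with boundary `M`. -/
abbrev RMetric (n : ℕ) [NeZero n] (M : Type*) [TopologicalSpace M]
    [ChartedSpace (EuclideanHalfSpace n) M] [IsManifold (𝓡∂ n) ∞ M] : Type _ :=
  ContMDiffRiemannianMetric (𝓡∂ n) ∞ (Coord n) (fun x : M => TangentSpace (𝓡∂ n) x)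

section Geometry

variable {n : ℕ} [NeZero n] {M : Type*} [TopologicalSpace M]
  [ChartedSpace (EuclideanHalfSpace n) M] [IsManifold (𝓡∂ n) ∞ M]

/-! ### The metric in coordinates and geodesics of `M` -/

/-- The metric in the chart `e`, at the coordinate point `y`, on the coordinate vectors `u`, `w`:
the number `∑ g_{jk}(y) u^j w^k`. -/
def metricInChart (g : RMetric n M) (e : OpenPartialHomeomorph M (EuclideanHalfSpace n))
    (y u w : Coord n) : ℝ :=
  g.inner ((e.extend (𝓡∂ n)).symm y)
    (mfderivWithin 𝓘(ℝ, Coord n) (𝓡∂ n) (e.extend (𝓡∂ n)).symm (range (𝓡∂ n)) y u)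
    (mfderivWithin 𝓘(ℝ, Coord n) (𝓡∂ n) (e.extend (𝓡∂ n)).symm (range (𝓡∂ n)) y w)

/-- The derivative at `y`, in the direction `z`, of the metric coefficients in the chart `e`:
the number `∑ ∂_l g_{jk}(y) z^l u^j w^k` (one-sided at the boundary). -/
def metricDerivInChart (g : RMetric n M) (e : OpenPartialHomeomorph M (EuclideanHalfSpace n))
    (y z u w : Coord n) : ℝ :=
  fderivWithin ℝ (fun y' => metricInChart g e y' u w) (range (𝓡∂ n)) y z

/-- The velocity at time `t` of a curve in `M`, computed along the set of times `s`. -/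
def velocity (c : ℝ → M) (s : Set ℝ) (t : ℝ) : TangentSpace (𝓡∂ n) (c t) :=
  mfderivWithin 𝓘(ℝ, ℝ) (𝓡∂ n) c s t (1 : ℝ)

/-- The curve `c` is a unit speed geodesic of `(M, g)` on the (nondegenerate) interval `s`: it is
`C²` on `s`, and in coordinates
`∑ g_{jk} x''^j w^k + ∑ ∂_l g_{jk} x'^l x'^j w^k - (1/2) ∑ ∂_l g_{jk} w^l x'^j x'^k = 0`
for all `w`, which is the geodesic equation `x''^i + Γ^i_{jk} x'^j x'^k = 0` with its index
lowered. The metric being smooth up to `∂M`, this also makes sense where `c` meets `∂M`. -/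
def IsGeodesicOn (g : RMetric n M) (c : ℝ → M) (s : Set ℝ) : Prop :=
  ContMDiffOn 𝓘(ℝ, ℝ) (𝓡∂ n) 2 c s ∧
  ∀ t ∈ s,
    g.inner (c t) (velocity (n := n) c s t) (velocity (n := n) c s t) = 1 ∧
    let e := chartAt (EuclideanHalfSpace n) (c t)
    let x : ℝ → Coord n := fun r => e.extend (𝓡∂ n) (c r)
    let v := derivWithin x s t
    let a := derivWithin (derivWithin x s) s t
    ∀ w : Coord n,
      metricInChart g e (x t) a w + metricDerivInChart g e (x t) v v w
        - (1 / 2) * metricDerivInChart g e (x t) w v v = 0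

/-! ### Hyperplanes, the reflection law -/

/-- `v` is tangent to `∂M` at the boundary point `x`. -/
def IsTangentToBoundary (x : M) (v : TangentSpace (𝓡∂ n) x) : Prop :=
  let u : Coord n := mfderiv (𝓡∂ n) 𝓘(ℝ, Coord n) (extChartAt (𝓡∂ n) x) x v
  u 0 = 0

/-- `ρ` is a local `C¹` defining function of the set `A` at its boundary point `x`. -/
structure IsDefiningFunctionAt (A : Set M) (ρ : M → ℝ) (x : M) : Prop where
  contMDiffAt : ContMDiffAt (𝓡∂ n) 𝓘(ℝ, ℝ) 1 ρ x
  eq_zero : ρ x = 0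
  mfderiv_ne_zero : mfderiv (𝓡∂ n) 𝓘(ℝ, ℝ) ρ x ≠ 0
  mem_iff : ∀ᶠ y in 𝓝 x, y ∈ A ↔ 0 ≤ ρ y

/-- `v` lies in the kernel of `dρ` at `x`, that is, it is tangent to the level set of `ρ`. -/
def IsTangentToLevel (ρ : M → ℝ) (x : M) (v : TangentSpace (𝓡∂ n) x) : Prop :=
  (mfderiv (𝓡∂ n) 𝓘(ℝ, ℝ) ρ x v : ℝ) = 0

/-- The law of reflection in the hyperplane `T ⊆ T_x M`: the component of the velocity tangent
to `T` is kept and the component normal to `T` changes its sign. -/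
def ReflectionLaw (g : RMetric n M) {x : M} (T : TangentSpace (𝓡∂ n) x → Prop)
    (vIn vOut : TangentSpace (𝓡∂ n) x) : Prop :=
  T (vIn + vOut) ∧ ∀ w, T w → g.inner x (vOut - vIn) w = 0

/-! ### The set `A` -/

/-- The assumptions on `A`: it is the closure of its interior, it meets `∂M`, and its boundary
(in the topology of `M`) is `C¹` and meets `∂M` orthogonally: the normal of `∂M` is tangent
to `∂A`. -/
structure IsReflectable (g : RMetric n M) (A : Set M) : Prop where
  isClosed : IsClosed A
  eq_closure_interior : A = closure (interior A)
  meets_boundary : (A ∩ (𝓡∂ n).boundary M).Nonempty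
  smooth_orthogonal : ∀ x ∈ frontier A, ∃ ρ : M → ℝ, IsDefiningFunctionAt (n := n) A ρ x ∧
    (x ∈ (𝓡∂ n).boundary M → ∀ ν : TangentSpace (𝓡∂ n) x,
      (∀ w, IsTangentToBoundary x w → g.inner x ν w = 0) → IsTangentToLevel ρ x ν)

/-- The reflecting part `R = ∂M ∩ int A` (interior in the topology of `M`). -/
def reflector (n : ℕ) [NeZero n] {M : Type*} [TopologicalSpace M]
    [ChartedSpace (EuclideanHalfSpace n) M] (A : Set M) : Set M :=
  (𝓡∂ n).boundary M ∩ interior A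

/-- The set of tomography `E = ∂A \ ∂M`. -/
def tomographySet (n : ℕ) [NeZero n] {M : Type*} [TopologicalSpace M]
    [ChartedSpace (EuclideanHalfSpace n) M] (A : Set M) : Set M :=
  frontier A \ (𝓡∂ n).boundary M

/-- The corner set `C = ∂M ∩ ∂A`. -/
def cornerSet (n : ℕ) [NeZero n] {M : Type*} [TopologicalSpace M]
    [ChartedSpace (EuclideanHalfSpace n) M] (A : Set M) : Set M :=
  (𝓡∂ n).boundary M ∩ frontier A

/-! ### Broken rays -/

open Classical in
/-- The unit speed curve `c : [0, L] → A` is a broken ray with endpoints in `E ∪ C`. It is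
piecewise geodesic (every time has a one-sided neighbourhood, on either side, on which `c` is a
geodesic; by compactness there are finitely many pieces). At each intermediate time the incoming
velocity is reflected in `T∂M` if the point is on `∂M`, and in `T∂A` if the point is on `∂A`
(in both at a corner), and is unchanged if it is on neither. The values of `c` outside `[0, L]`
are irrelevant. -/
structure IsBrokenRay (g : RMetric n M) (A : Set M) (L : ℝ) (c : ℝ → A) : Prop where
  pos : 0 < L
  start_mem : (c 0 : M) ∈ tomographySet n A ∪ cornerSet n A
  end_mem : (c L : M) ∈ tomographySet n A ∪ cornerSet n A
  geodesic_right : ∀ t ∈ Ico 0 L, ∃ ε > 0, t + ε ≤ L ∧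
    IsGeodesicOn g (fun r => (c r : M)) (Icc t (t + ε))
  geodesic_left : ∀ t ∈ Ioc 0 L, ∃ ε > 0, 0 ≤ t - ε ∧
    IsGeodesicOn g (fun r => (c r : M)) (Icc (t - ε) t)
  reflection : ∀ t ∈ Ioo 0 L, ∃ u : TangentSpace (𝓡∂ n) (c t : M),
    (if (c t : M) ∈ (𝓡∂ n).boundary M
      then ReflectionLaw g (IsTangentToBoundary (c t : M))
        (velocity (n := n) (fun r => (c r : M)) (Iic t) t) u
      else u = velocity (n := n) (fun r => (c r : M)) (Iic t) t) ∧
    (if (c t : M) ∈ frontier A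
      then ∃ ρ : M → ℝ, IsDefiningFunctionAt (n := n) A ρ (c t : M) ∧
        ReflectionLaw g (IsTangentToLevel ρ (c t : M))
          u (velocity (n := n) (fun r => (c r : M)) (Ici t) t)
      else velocity (n := n) (fun r => (c r : M)) (Ici t) t = u)

/-! ### The doubled manifold -/

/-- Two copies of `A`, labelled by `false` and `true`, are glued along the closure of `R`. -/
def doubleSetoid (n : ℕ) [NeZero n] {M : Type*} [TopologicalSpace M]
    [ChartedSpace (EuclideanHalfSpace n) M] (A : Set M) : Setoid (Bool × A) where
  r p q := p.2 = q.2 ∧ (p.1 = q.1 ∨ (p.2 : M) ∈ closure (reflector n A))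
  iseqv :=
    { refl := fun _ => ⟨rfl, Or.inl rfl⟩
      symm := by
        rintro ⟨i, x⟩ ⟨j, y⟩ ⟨h, h'⟩
        dsimp only at h h'
        subst h
        exact ⟨rfl, h'.imp Eq.symm id⟩
      trans := by
        rintro ⟨i, x⟩ ⟨j, y⟩ ⟨k, z⟩ ⟨h, h'⟩ ⟨l, l'⟩
        dsimp only at h h' l l'
        subst h
        subst l
        refine ⟨rfl, ?_⟩
        rcases h' with h' | h'
        · rcases l' with l' | l'
          · exact Or.inl (h'.trans l')
          · exact Or.inr l'
        · exact Or.inr h' }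

/-- The double `Ã` of `A`. -/
def Double (n : ℕ) [NeZero n] {M : Type*} [TopologicalSpace M]
    [ChartedSpace (EuclideanHalfSpace n) M] (A : Set M) : Type _ :=
  Quotient (doubleSetoid n A)

instance instTopologicalSpaceDouble (A : Set M) : TopologicalSpace (Double n A) :=
  inferInstanceAs (TopologicalSpace (Quotient (doubleSetoid n A)))

/-- The natural injections of the two copies into the double. -/
def copy (n : ℕ) [NeZero n] {M : Type*} [TopologicalSpace M]
    [ChartedSpace (EuclideanHalfSpace n) M] (A : Set M) (i : Bool) (x : A) : Double n A :=
  Quotient.mk (doubleSetoid n A) (i, x)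

/-- The natural projection `π : Ã → A`. -/
def proj (n : ℕ) [NeZero n] {M : Type*} [TopologicalSpace M]
    [ChartedSpace (EuclideanHalfSpace n) M] (A : Set M) : Double n A → A :=
  Quotient.lift (fun p : Bool × A => p.2) (fun _ _ h => h.1)

/-- The boundary of the double: the two copies of `E`, and the common image of `C`. -/
def doubleBoundary (n : ℕ) [NeZero n] {M : Type*} [TopologicalSpace M]
    [ChartedSpace (EuclideanHalfSpace n) M] (A : Set M) : Set (Double n A) :=
  {q | (proj n A q : M) ∈ tomographySet n A ∪ cornerSet n A}

/-- `e` is a system of boundary normal coordinates: in these coordinates `g_{00} = 1` and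
`g_{0j} = 0` for `j ≠ 0`, where the coordinate `0` is nonnegative and vanishes exactly on `∂M`. -/
def IsBoundaryNormalChart (g : RMetric n M)
    (e : OpenPartialHomeomorph M (EuclideanHalfSpace n)) : Prop :=
  e ∈ IsManifold.maximalAtlas (𝓡∂ n) ∞ M ∧
  ∀ y ∈ (e.extend (𝓡∂ n)).target, ∀ w : Coord n,
    metricInChart g e y (EuclideanSpace.single 0 1) w = w 0

open Classical in
/-- The coordinates on the double induced by boundary normal coordinates `e`: those of `e` on the
first copy, and those of `e` with the sign of the normal coordinate changed on the second one. -/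
def doubleCoord {A : Set M} (e : OpenPartialHomeomorph M (EuclideanHalfSpace n))
    (q : Double n A) : Coord n :=
  let y : Coord n := e.extend (𝓡∂ n) (proj n A q : M)
  if q ∈ range (copy n A true) then y - (2 * y 0) • EuclideanSpace.single 0 1 else y

/-- The curve `φ` in the double is `C¹` at time `t`: off `∂M` the projection `π` is a local
diffeomorphism and is used to read the curve in `M`; on the seam, where `π` is not smooth, the
curve is read in doubled boundary normal coordinates. -/
def IsC1At (g : RMetric n M) {A : Set M} (φ : ℝ → Double n A) (t : ℝ) : Prop :=
  ((proj n A (φ t) : M) ∉ (𝓡∂ n).boundary M →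
    ContMDiffAt 𝓘(ℝ, ℝ) (𝓡∂ n) 1 (fun r => (proj n A (φ r) : M)) t) ∧
  ((proj n A (φ t) : M) ∈ (𝓡∂ n).boundary M →
    ∃ e : OpenPartialHomeomorph M (EuclideanHalfSpace n),
      IsBoundaryNormalChart g e ∧ (proj n A (φ t) : M) ∈ e.source ∧
      ContDiffAt ℝ 1 (fun r => doubleCoord e (φ r)) t)

/-- On the set of times `s` the curve `φ` stays in one copy of `A` and is a unit speed geodesic
for the reflected metric `π^* g`, which is smooth up to the seam on each copy. -/
def IsGeodesicInCopy (g : RMetric n M) {A : Set M} (φ : ℝ → Double n A) (s : Set ℝ) : Prop :=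
  (∃ i : Bool, ∀ r ∈ s, φ r ∈ range (copy n A i)) ∧
  IsGeodesicOn g (fun r => (proj n A (φ r) : M)) s

/-- `φ : [0, L] → Ã` is a unit speed geodesic of the double, for the reflected metric, joining
two boundary points. The reflected metric is smooth on each copy up to the seam, but in general
only Lipschitz across the seam. Hence a geodesic is a `C¹` curve for the smooth structure of the
double such that to the left and to the right of each time it satisfies the geodesic equation
in one of the copies. The values of `φ` outside `[0, L]` are irrelevant. -/
structure IsDoubleGeodesic (g : RMetric n M) (A : Set M) (L : ℝ) (φ : ℝ → Double n A) : Prop where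
  pos : 0 < L
  continuousOn : ContinuousOn φ (Icc 0 L)
  start_mem : φ 0 ∈ doubleBoundary n A
  end_mem : φ L ∈ doubleBoundary n A
  geodesic_right : ∀ t ∈ Ico 0 L, ∃ ε > 0, t + ε ≤ L ∧ IsGeodesicInCopy g φ (Icc t (t + ε))
  geodesic_left : ∀ t ∈ Ioc 0 L, ∃ ε > 0, 0 ≤ t - ε ∧ IsGeodesicInCopy g φ (Icc (t - ε) t)
  c1 : ∀ t ∈ Ioo 0 L, IsC1At g φ t

/-! ### The transforms -/

/-- `∫_0^L f(c(t)) exp(∫_0^t h(c(s)) ds) dt`. -/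
def attenuatedIntegral {X : Type*} (h f : X → ℝ) (L : ℝ) (c : ℝ → X) : ℝ :=
  ∫ t in (0 : ℝ)..L, f (c t) * Real.exp (∫ s in (0 : ℝ)..t, h (c s))

/-- `Γ(Ã)`: the geodesics of the double joining boundary points, with their lengths. -/
def geodesics (g : RMetric n M) (A : Set M) : Set (ℝ × (ℝ → Double n A)) :=
  {p | IsDoubleGeodesic g A p.1 p.2}

/-- `Γ_E(A)`: the broken rays of `A`, with their lengths. -/
def brokenRays (g : RMetric n M) (A : Set M) : Set (ℝ × (ℝ → A)) :=
  {p | IsBrokenRay g A p.1 p.2}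

/-- The attenuated geodesic ray transform on the double. -/
def geodesicRayTransform (g : RMetric n M) (A : Set M) (h f : Double n A → ℝ) :
    geodesics g A → ℝ :=
  fun γ => attenuatedIntegral h f γ.1.1 γ.1.2

/-- The attenuated broken ray transform on `A`. -/
def brokenRayTransform (g : RMetric n M) (A : Set M) (h f : A → ℝ) : brokenRays g A → ℝ :=
  fun γ => attenuatedIntegral h f γ.1.1 γ.1.2

/-- The reflected function `π^* f`. -/
def reflect (n : ℕ) [NeZero n] {M : Type*} [TopologicalSpace M]
    [ChartedSpace (EuclideanHalfSpace n) M] {A : Set M} (f : A → ℝ) : Double n A → ℝ :=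
  f ∘ proj n A

/-- The reflected class of functions. -/
def reflectClass (n : ℕ) [NeZero n] {M : Type*} [TopologicalSpace M]
    [ChartedSpace (EuclideanHalfSpace n) M] {A : Set M} (F : Set (A → ℝ)) :
    Set (Double n A → ℝ) :=
  reflect n '' F

end Geometry

end BrokenRay

end

/-!
In doubled boundary normal coordinates the projection `π : Ã → A` is the folding of `ℝⁿ` onto the
half space. Hence, where a `C¹` curve `φ` in the double meets the seam, the one-sided velocities of
`π ∘ φ` differ by a change of sign of the normal component, which is the law of reflection in `∂M`.
Where `π ∘ φ` meets `∂A`, the defining function `ρ ≥ 0` is minimal along it, so `dρ` is nonpositive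
on the incoming velocity and nonnegative on the outgoing one. The two values agree, since the
velocities differ at most by a normal vector of `∂M`, which is tangent to `∂A` by orthogonality.
Hence `π ∘ φ` touches `∂A` tangentially, where reflection in `∂A` changes nothing, even at a corner.

So `φ ↦ π ∘ φ` maps `Γ(Ã)` to `Γ_E(A)`, and composition with this map turns `G_h f` into the
transform of the reflected functions, which determine `h` and `f` because `π` is surjective.
-/

namespace BrokenRay

section OneSidedDerivative

theorem nonneg_of_isLocalMinOn_Ici {f : ℝ → ℝ} {f' t : ℝ} (hmin : IsLocalMinOn f (Ici t) t)
    (hf : HasDerivWithinAt f f' (Ici t) t) : 0 ≤ f' := by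
  simpa using hmin.hasFDerivWithinAt_nonneg hf.hasFDerivWithinAt
    (y := 1) (mem_posTangentConeAt_of_segment_subset <|
      (convex_Ici t).segment_subset self_mem_Ici (by simp))

theorem nonpos_of_isLocalMinOn_Iic {f : ℝ → ℝ} {f' t : ℝ} (hmin : IsLocalMinOn f (Iic t) t)
    (hf : HasDerivWithinAt f f' (Iic t) t) : f' ≤ 0 := by
  simpa using hmin.hasFDerivWithinAt_nonneg hf.hasFDerivWithinAt
    (y := -1) (mem_posTangentConeAt_of_segment_subset <|
      (convex_Iic t).segment_subset self_mem_Iic (by simp))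

variable {V : Type*} [NormedAddCommGroup V] [NormedSpace ℝ V] {f : ℝ → V} {f' : V} {t : ℝ}

theorem hasDerivWithinAt_norm_Ici_of_eq_zero (hf : HasDerivWithinAt f f' (Ici t) t)
    (h0 : f t = 0) : HasDerivWithinAt (fun r => ‖f r‖) ‖f'‖ (Ici t) t := by
  rw [← hasDerivWithinAt_Ioi_iff_Ici, hasDerivWithinAt_iff_tendsto_slope' self_notMem_Ioi] at hf ⊢
  refine hf.norm.congr' ?_
  filter_upwards [self_mem_nhdsWithin] with r (hr : t < r)
  simp [slope, h0, norm_smul, abs_of_pos (sub_pos.2 hr)]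

theorem hasDerivWithinAt_norm_Iic_of_eq_zero (hf : HasDerivWithinAt f f' (Iic t) t)
    (h0 : f t = 0) : HasDerivWithinAt (fun r => ‖f r‖) (-‖f'‖) (Iic t) t := by
  rw [← hasDerivWithinAt_Iio_iff_Iic, hasDerivWithinAt_iff_tendsto_slope' self_notMem_Iio] at hf ⊢
  refine hf.norm.neg.congr' ?_
  filter_upwards [self_mem_nhdsWithin] with r (hr : r < t)
  simp only [slope, vsub_eq_sub, h0, norm_zero, sub_zero, norm_smul, norm_inv, Real.norm_eq_abs,
    abs_of_neg (sub_neg.2 hr), inv_neg, neg_mul, smul_eq_mul, neg_neg]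

end OneSidedDerivative

section Fold

variable {n : ℕ} [NeZero n]

/-- The folding of `ℝⁿ` onto the closed half space, which replaces the coordinate `0` by its
absolute value: the projection `π` of the double, read in doubled boundary normal coordinates. -/
noncomputable def fold (y : Coord n) : Coord n :=
  y + (|y 0| - y 0) • EuclideanSpace.single 0 1

theorem fold_apply_zero (y : Coord n) : fold y 0 = |y 0| := by
  simp [fold]

theorem fold_add_fold_neg (y : Coord n) :
    fold y + fold (-y) = (2 * |y 0|) • EuclideanSpace.single 0 1 := by
  simp only [fold, PiLp.neg_apply, abs_neg]
  module

variable {y : ℝ → Coord n} {y' : Coord n} {t : ℝ}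

theorem hasDerivWithinAt_fold_Ici (hy : HasDerivWithinAt y y' (Ici t) t) (h0 : y t 0 = 0) :
    HasDerivWithinAt (fun r => fold (y r)) (fold y') (Ici t) t := by
  have hy0 := (EuclideanSpace.proj (𝕜 := ℝ) (0 : Fin n)).hasFDerivAt.comp_hasDerivWithinAt t hy
  exact hy.add (((hasDerivWithinAt_norm_Ici_of_eq_zero hy0 h0).sub hy0).smul_const _)

theorem hasDerivWithinAt_fold_Iic (hy : HasDerivWithinAt y y' (Iic t) t) (h0 : y t 0 = 0) :
    HasDerivWithinAt (fun r => fold (y r)) (-fold (-y')) (Iic t) t := by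
  have hy0 := (EuclideanSpace.proj (𝕜 := ℝ) (0 : Fin n)).hasFDerivAt.comp_hasDerivWithinAt t hy
  refine (hy.add (((hasDerivWithinAt_norm_Iic_of_eq_zero hy0 h0).sub hy0).smul_const
    (EuclideanSpace.single 0 1))).congr_deriv ?_
  simp only [fold, PiLp.neg_apply, abs_neg, EuclideanSpace.coe_proj, Real.norm_eq_abs]
  module

end Fold

section Chart

variable {E H M : Type*} [NormedAddCommGroup E] [NormedSpace ℝ E] [TopologicalSpace H]
  {I : ModelWithCorners ℝ E H} [TopologicalSpace M] [ChartedSpace H M] {k : WithTop ℕ∞}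
  {e : OpenPartialHomeomorph M H} {x : M}

theorem mdifferentiableAt_extend (he : e ∈ IsManifold.maximalAtlas I k M) (hk : k ≠ 0)
    (hx : x ∈ e.source) : MDifferentiableAt I 𝓘(ℝ, E) (e.extend I) x :=
  (e.contMDiffAt_extend he hx).mdifferentiableAt hk

theorem mdifferentiableWithinAt_extend_symm (he : e ∈ IsManifold.maximalAtlas I k M) (hk : k ≠ 0)
    (hx : x ∈ e.source) :
    MDifferentiableWithinAt 𝓘(ℝ, E) I (e.extend I).symm (range I) (e.extend I x) := by
  refine ((contMDiffOn_extend_symm he).mdifferentiableOn hk _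
    (mem_image_of_mem _ (e.map_source hx))).mono_of_mem_nhdsWithin ?_
  rw [← e.extend_target']
  exact e.extend_target_mem_nhdsWithin hx

theorem mfderivWithin_extend_symm_mvfderiv_extend (he : e ∈ IsManifold.maximalAtlas I k M)
    (hk : k ≠ 0) (hx : x ∈ e.source) (v : TangentSpace I x) :
    mfderivWithin 𝓘(ℝ, E) I (e.extend I).symm (range I) (e.extend I x)
      (mvfderiv I (e.extend I) x v) = v := by
  have hcomp := (mdifferentiableWithinAt_extend_symm he hk hx).hasMFDerivWithinAt.comp x
    (mdifferentiableAt_extend he hk hx).hasMFDerivAt.hasMFDerivWithinAt (s := univ)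
    fun y _ => mem_range_self _
  have hid := (hasMFDerivWithinAt_univ.1 hcomp).congr_of_eventuallyEq (f₁ := id) <| by
    filter_upwards [e.open_source.mem_nhds hx] with y hy
    exact (e.extend_left_inv hy).symm
  exact congrArg (· v) (hasMFDerivAt_unique hid (hasMFDerivAt_id x))

theorem isInteriorPoint_of_extend_mem_interior_range
    (he : e ∈ IsManifold.maximalAtlas I k M) (hk : k ≠ 0) (hx : x ∈ e.source)
    (h : e.extend I x ∈ interior (range I)) : I.IsInteriorPoint x := by
  have hdiff : e.MDifferentiable I I :=
    ⟨(contMDiffOn_of_mem_maximalAtlas he).mdifferentiableOn hk,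
      (contMDiffOn_symm_of_mem_maximalAtlas he).mdifferentiableOn hk⟩
  have hex := e.map_source hx
  rw [← e.left_inv hx]
  refine (hdiff.symm.mdifferentiableAt hex).isInteriorPoint_of_surjective_mfderiv
    (hdiff.symm.mfderiv_surjective hex) ?_
  simpa [ModelWithCorners.IsInteriorPoint, extChartAt, chartAt_self_eq] using h

theorem mvfderiv_eq_zero_of_isLocalMin (he : e ∈ IsManifold.maximalAtlas I k M) (hk : k ≠ 0)
    (hx : x ∈ e.source) {f : M → ℝ} (hf : MDifferentiableAt I 𝓘(ℝ, ℝ) f x)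
    (hmin : IsLocalMin f x) {v : TangentSpace I x}
    (hv : mvfderiv I (e.extend I) x v ∈ posTangentConeAt (range I) (e.extend I x))
    (hv' : -mvfderiv I (e.extend I) x v ∈ posTangentConeAt (range I) (e.extend I x)) :
    mvfderiv I f x v = 0 := by
  have hsymm := mdifferentiableWithinAt_extend_symm he hk hx
  have hleft := e.extend_left_inv (I := I) hx
  have hmin' : IsLocalMinOn (f ∘ (e.extend I).symm) (range I) (e.extend I x) := by
    have hcont := (e.continuousAt_extend_symm (I := I) hx).tendsto
    rw [hleft] at hcont
    filter_upwards [nhdsWithin_le_nhds (hcont.eventually hmin)] with y hy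
    simpa only [Function.comp_apply, hleft] using hy
  have hderiv : HasFDerivWithinAt (f ∘ (e.extend I).symm)
      ((mvfderiv I f x).comp
        (mfderivWithin 𝓘(ℝ, E) I (e.extend I).symm (range I) (e.extend I x)))
      (range I) (e.extend I x) := by
    have hf' : HasMFDerivAt I 𝓘(ℝ, ℝ) f ((e.extend I).symm (e.extend I x))
        (mfderiv I 𝓘(ℝ, ℝ) f x) := hleft.symm ▸ hf.hasMFDerivAt
    exact hasMFDerivWithinAt_iff_hasFDerivWithinAt.1
      (hf'.comp_hasMFDerivWithinAt _ hsymm.hasMFDerivWithinAt)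
  have hzero := hmin'.hasFDerivWithinAt_eq_zero hderiv hv hv'
  exact (congrArg (mvfderiv I f x)
    (mfderivWithin_extend_symm_mvfderiv_extend he hk hx v)).symm.trans hzero

end Chart

section HalfSpaceChart

variable {n : ℕ} [NeZero n] {M : Type*} [TopologicalSpace M]

theorem extend_apply_zero_nonneg (e : OpenPartialHomeomorph M (EuclideanHalfSpace n)) (x : M) :
    0 ≤ e.extend (𝓡∂ n) x 0 :=
  (e x).2

variable [ChartedSpace (EuclideanHalfSpace n) M] {k : WithTop ℕ∞}
  {e e' : OpenPartialHomeomorph M (EuclideanHalfSpace n)} {x : M} {v : TangentSpace (𝓡∂ n) x}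

theorem extend_apply_zero_eq_zero_of_mem_boundary
    (he : e ∈ IsManifold.maximalAtlas (𝓡∂ n) k M) (hk : k ≠ 0) (hx : x ∈ e.source)
    (hb : x ∈ (𝓡∂ n).boundary M) : e.extend (𝓡∂ n) x 0 = 0 := by
  rw [← (𝓡∂ n).compl_interior] at hb
  contrapose! hb
  refine not_not.2 (isInteriorPoint_of_extend_mem_interior_range he hk hx ?_)
  rw [interior_range_modelWithCornersEuclideanHalfSpace]
  exact (extend_apply_zero_nonneg e x).lt_of_ne' hb

theorem mvfderiv_extend_apply_zero_eq_zero
    (he : e ∈ IsManifold.maximalAtlas (𝓡∂ n) k M)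
    (he' : e' ∈ IsManifold.maximalAtlas (𝓡∂ n) k M) (hk : k ≠ 0) (hx : x ∈ e.source)
    (hx' : x ∈ e'.source) (hb : x ∈ (𝓡∂ n).boundary M)
    (hv : mvfderiv (𝓡∂ n) (e.extend (𝓡∂ n)) x v 0 = 0) :
    mvfderiv (𝓡∂ n) (e'.extend (𝓡∂ n)) x v 0 = 0 := by
  let p : Coord n →L[ℝ] ℝ := EuclideanSpace.proj 0
  have hd : HasMFDerivAt (𝓡∂ n) 𝓘(ℝ, ℝ) (p ∘ e'.extend (𝓡∂ n)) x
      (p.comp (mvfderiv (𝓡∂ n) (e'.extend (𝓡∂ n)) x)) :=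
    p.hasMFDerivAt.comp x (mdifferentiableAt_extend he' hk hx').hasMFDerivAt
  have hmin : IsLocalMin (p ∘ e'.extend (𝓡∂ n)) x := Eventually.of_forall fun z =>
    (extend_apply_zero_eq_zero_of_mem_boundary he' hk hx' hb).trans_le
      (extend_apply_zero_nonneg e' z)
  have htangent : ∀ u : Coord n, u 0 = 0 →
      u ∈ posTangentConeAt (range (𝓡∂ n)) (e.extend (𝓡∂ n) x) := fun u hu => by
    refine mem_posTangentConeAt_of_segment_subset
      ((𝓡∂ n).convex_range.segment_subset (mem_range_self _) ?_)
    rw [range_modelWithCornersEuclideanHalfSpace]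
    simpa [hu] using extend_apply_zero_nonneg e x
  have h0 := mvfderiv_eq_zero_of_isLocalMin he hk hx hd.mdifferentiableAt hmin
    (htangent _ hv) (htangent _ (by simpa using hv))
  rw [mvfderiv, hd.mfderiv] at h0
  exact h0

theorem isTangentToBoundary_iff [IsManifold (𝓡∂ n) k M]
    (he : e ∈ IsManifold.maximalAtlas (𝓡∂ n) k M) (hk : k ≠ 0) (hx : x ∈ e.source)
    (hb : x ∈ (𝓡∂ n).boundary M) :
    IsTangentToBoundary x v ↔ mvfderiv (𝓡∂ n) (e.extend (𝓡∂ n)) x v 0 = 0 := by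
  have hc : chartAt (EuclideanHalfSpace n) x ∈ IsManifold.maximalAtlas (𝓡∂ n) k M :=
    IsManifold.chart_mem_maximalAtlas x
  exact ⟨mvfderiv_extend_apply_zero_eq_zero hc he hk (mem_chart_source _ x) hx hb,
    mvfderiv_extend_apply_zero_eq_zero he hc hk hx (mem_chart_source _ x) hb⟩

end HalfSpaceChart

section Velocity

variable {n : ℕ} [NeZero n] {M : Type*} [TopologicalSpace M]
  [ChartedSpace (EuclideanHalfSpace n) M] {c : ℝ → M} {s : Set ℝ} {t : ℝ}

theorem hasDerivWithinAt_comp_velocity {V : Type*} [NormedAddCommGroup V] [NormedSpace ℝ V]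
    {f : M → V} (hf : MDifferentiableAt (𝓡∂ n) 𝓘(ℝ, V) f (c t))
    (hc : MDifferentiableWithinAt 𝓘(ℝ, ℝ) (𝓡∂ n) c s t) :
    HasDerivWithinAt (fun r => f (c r)) (mvfderiv (𝓡∂ n) f (c t) (velocity c s t)) s t :=
  HasFDerivWithinAt.hasDerivWithinAt
    (f' := (mvfderiv (𝓡∂ n) f (c t)).comp (mfderivWithin 𝓘(ℝ, ℝ) (𝓡∂ n) c s t))
    (hasMFDerivWithinAt_iff_hasFDerivWithinAt.1
      (hf.hasMFDerivAt.comp_hasMFDerivWithinAt t hc.hasMFDerivWithinAt))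

theorem velocity_Ici_eq_velocity_Iic (hc : MDifferentiableAt 𝓘(ℝ, ℝ) (𝓡∂ n) c t) :
    velocity (n := n) c (Ici t) t = velocity c (Iic t) t := by
  simp only [velocity, mfderivWithin_eq_mfderiv (uniqueDiffWithinAt_Ici t).uniqueMDiffWithinAt hc,
    mfderivWithin_eq_mfderiv (uniqueDiffWithinAt_Iic t).uniqueMDiffWithinAt hc]

theorem IsDefiningFunctionAt.mvfderiv_velocity_eq_zero {A : Set M} {ρ : M → ℝ}
    (hρ : IsDefiningFunctionAt (n := n) A ρ (c t)) (hcA : ∀ r, c r ∈ A)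
    (hl : MDifferentiableWithinAt 𝓘(ℝ, ℝ) (𝓡∂ n) c (Iic t) t)
    (hr : MDifferentiableWithinAt 𝓘(ℝ, ℝ) (𝓡∂ n) c (Ici t) t)
    (heq : mvfderiv (𝓡∂ n) ρ (c t) (velocity c (Ici t) t) =
      mvfderiv (𝓡∂ n) ρ (c t) (velocity c (Iic t) t)) :
    mvfderiv (𝓡∂ n) ρ (c t) (velocity c (Ici t) t) = 0 := by
  have hd : MDifferentiableAt (𝓡∂ n) 𝓘(ℝ, ℝ) ρ (c t) :=
    hρ.contMDiffAt.mdifferentiableAt one_ne_zero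
  have hmin : ∀ s : Set ℝ, MDifferentiableWithinAt 𝓘(ℝ, ℝ) (𝓡∂ n) c s t →
      IsLocalMinOn (fun r => ρ (c r)) s t := fun s hs => by
    filter_upwards [hs.continuousWithinAt.eventually hρ.mem_iff] with r h
    exact hρ.eq_zero.trans_le (h.1 (hcA r))
  exact le_antisymm
    (heq.trans_le (nonpos_of_isLocalMinOn_Iic (hmin _ hl) (hasDerivWithinAt_comp_velocity hd hl)))
    (nonneg_of_isLocalMinOn_Ici (hmin _ hr) (hasDerivWithinAt_comp_velocity hd hr))

variable [IsManifold (𝓡∂ n) ∞ M] {g : RMetric n M} {ε : ℝ}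

theorem IsGeodesicOn.mdifferentiableWithinAt_Ici (hε : 0 < ε)
    (h : IsGeodesicOn g c (Icc t (t + ε))) :
    MDifferentiableWithinAt 𝓘(ℝ, ℝ) (𝓡∂ n) c (Ici t) t :=
  (h.1.mdifferentiableOn two_ne_zero t ⟨le_rfl, by linarith⟩).mono_of_mem_nhdsWithin
    (Icc_mem_nhdsGE (by linarith))

theorem IsGeodesicOn.mdifferentiableWithinAt_Iic (hε : 0 < ε)
    (h : IsGeodesicOn g c (Icc (t - ε) t)) :
    MDifferentiableWithinAt 𝓘(ℝ, ℝ) (𝓡∂ n) c (Iic t) t :=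
  (h.1.mdifferentiableOn two_ne_zero t ⟨by linarith, le_rfl⟩).mono_of_mem_nhdsWithin
    (Icc_mem_nhdsLE (by linarith))

end Velocity

section Metric

variable {n : ℕ} [NeZero n] {M : Type*} [TopologicalSpace M]
  [ChartedSpace (EuclideanHalfSpace n) M] [IsManifold (𝓡∂ n) ∞ M] {g : RMetric n M}
  {e : OpenPartialHomeomorph M (EuclideanHalfSpace n)} {x : M}

theorem metricInChart_mvfderiv_extend (he : e ∈ IsManifold.maximalAtlas (𝓡∂ n) ∞ M)
    (hx : x ∈ e.source) (v w : TangentSpace (𝓡∂ n) x) :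
    metricInChart g e (e.extend (𝓡∂ n) x) (mvfderiv (𝓡∂ n) (e.extend (𝓡∂ n)) x v)
      (mvfderiv (𝓡∂ n) (e.extend (𝓡∂ n)) x w) = g.inner x v w := by
  have hv := mfderivWithin_extend_symm_mvfderiv_extend he (by simp) hx v
  have hw := mfderivWithin_extend_symm_mvfderiv_extend he (by simp) hx w
  have hleft : (e.extend (𝓡∂ n)).symm (e.extend (𝓡∂ n) x) = x := e.extend_left_inv hx
  unfold metricInChart
  generalize e.extend (𝓡∂ n) x = y at *
  subst hleft
  exact congrArg₂ (fun a b => g.inner _ a b) hv hw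

theorem metricInChart_smul_left (y u w : Coord n) (a : ℝ) :
    metricInChart g e y (a • u) w = a * metricInChart g e y u w := by
  let D : Coord n →L[ℝ] TangentSpace (𝓡∂ n) ((e.extend (𝓡∂ n)).symm y) :=
    mfderivWithin 𝓘(ℝ, Coord n) (𝓡∂ n) (e.extend (𝓡∂ n)).symm (range (𝓡∂ n)) y
  change g.inner _ (D (a • u)) (D w) = a * g.inner _ (D u) (D w)
  rw [map_smul, map_smul, smul_apply, smul_eq_mul]

theorem IsBoundaryNormalChart.inner_eq (he : IsBoundaryNormalChart g e) (hx : x ∈ e.source)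
    {a : ℝ} {ν : TangentSpace (𝓡∂ n) x}
    (hν : mvfderiv (𝓡∂ n) (e.extend (𝓡∂ n)) x ν = a • EuclideanSpace.single 0 1)
    (w : TangentSpace (𝓡∂ n) x) :
    g.inner x ν w = a * mvfderiv (𝓡∂ n) (e.extend (𝓡∂ n)) x w 0 := by
  have hy : e.extend (𝓡∂ n) x ∈ (e.extend (𝓡∂ n)).target :=
    (e.extend (𝓡∂ n)).map_source (by rwa [e.extend_source])
  rw [← metricInChart_mvfderiv_extend he.1 hx, hν, metricInChart_smul_left, he.2 _ hy]

theorem IsBoundaryNormalChart.reflectionLaw (he : IsBoundaryNormalChart g e) (hx : x ∈ e.source)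
    (hb : x ∈ (𝓡∂ n).boundary M) {a : ℝ} {vIn vOut : TangentSpace (𝓡∂ n) x}
    (hadd : mvfderiv (𝓡∂ n) (e.extend (𝓡∂ n)) x (vIn + vOut) 0 = 0)
    (hsub : mvfderiv (𝓡∂ n) (e.extend (𝓡∂ n)) x (vOut - vIn) = a • EuclideanSpace.single 0 1) :
    ReflectionLaw g (IsTangentToBoundary x) vIn vOut := by
  have htangent := fun v => isTangentToBoundary_iff (v := v) he.1 (by simp) hx hb
  refine ⟨(htangent _).2 hadd, fun w hw => ?_⟩
  rw [he.inner_eq hx hsub, (htangent w).1 hw, mul_zero]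

end Metric

section Double

variable {n : ℕ} [NeZero n] {M : Type*} [TopologicalSpace M]
  [ChartedSpace (EuclideanHalfSpace n) M] {A : Set M}

theorem extend_proj_eq_fold_doubleCoord (e : OpenPartialHomeomorph M (EuclideanHalfSpace n))
    (q : Double n A) : e.extend (𝓡∂ n) (proj n A q) = fold (doubleCoord e q) := by
  have h0 := extend_apply_zero_nonneg e (proj n A q : M)
  simp only [doubleCoord]
  generalize e.extend (𝓡∂ n) (proj n A q : M) = y at h0 ⊢
  split_ifs
  · have hneg : (y - (2 * y 0) • EuclideanSpace.single 0 1 : Coord n) 0 = -y 0 := by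
      simp only [PiLp.sub_apply, PiLp.smul_apply, PiLp.single_apply, if_true, smul_eq_mul]
      ring
    rw [fold, hneg, abs_neg, abs_of_nonneg h0]
    module
  · rw [fold, abs_of_nonneg h0, sub_self, zero_smul, add_zero]

theorem reflect_injective : Function.Injective (reflect n : (A → ℝ) → Double n A → ℝ) :=
  fun _ _ h => funext fun x => congrFun h (copy n A false x)

/-- The projection to `M` of a curve in the double. -/
abbrev projCurve (φ : ℝ → Double n A) : ℝ → M := fun r => proj n A (φ r)

variable [IsManifold (𝓡∂ n) ∞ M] {g : RMetric n M} {φ : ℝ → Double n A} {t : ℝ}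

theorem IsC1At.velocity_Ici_eq_velocity_Iic (hφ : IsC1At g φ t)
    (hb : projCurve φ t ∉ (𝓡∂ n).boundary M) :
    velocity (n := n) (projCurve φ) (Ici t) t = velocity (projCurve φ) (Iic t) t :=
  BrokenRay.velocity_Ici_eq_velocity_Iic ((hφ.1 hb).mdifferentiableAt one_ne_zero)

theorem IsC1At.reflectionLaw (hφ : IsC1At g φ t) (hb : projCurve φ t ∈ (𝓡∂ n).boundary M)
    (hl : MDifferentiableWithinAt 𝓘(ℝ, ℝ) (𝓡∂ n) (projCurve φ) (Iic t) t)
    (hr : MDifferentiableWithinAt 𝓘(ℝ, ℝ) (𝓡∂ n) (projCurve φ) (Ici t) t) :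
    ReflectionLaw g (IsTangentToBoundary (projCurve φ t))
      (velocity (projCurve φ) (Iic t) t) (velocity (projCurve φ) (Ici t) t) := by
  obtain ⟨e, he, hx, hd⟩ := hφ.2 hb
  have hy := (hd.differentiableAt one_ne_zero).hasDerivAt
  set y := fun r => doubleCoord e (φ r)
  have hfold : (fun r => fold (y r)) = fun r => e.extend (𝓡∂ n) (projCurve φ r) :=
    funext fun r => (extend_proj_eq_fold_doubleCoord e (φ r)).symm
  have hy0 : y t 0 = 0 := by
    rw [← abs_eq_zero, ← fold_apply_zero, congrFun hfold t]
    exact extend_apply_zero_eq_zero_of_mem_boundary he.1 (by simp) hx hb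
  have hE := mdifferentiableAt_extend he.1 (by simp) hx
  have hout : mvfderiv (𝓡∂ n) (e.extend (𝓡∂ n)) (projCurve φ t)
      (velocity (projCurve φ) (Ici t) t) = fold (deriv y t) :=
    (uniqueDiffWithinAt_Ici t).eq_deriv _ (hasDerivWithinAt_comp_velocity hE hr)
      (hfold ▸ hasDerivWithinAt_fold_Ici hy.hasDerivWithinAt hy0)
  have hin : mvfderiv (𝓡∂ n) (e.extend (𝓡∂ n)) (projCurve φ t)
      (velocity (projCurve φ) (Iic t) t) = -fold (-deriv y t) :=
    (uniqueDiffWithinAt_Iic t).eq_deriv _ (hasDerivWithinAt_comp_velocity hE hl)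
      (hfold ▸ hasDerivWithinAt_fold_Iic hy.hasDerivWithinAt hy0)
  refine he.reflectionLaw hx hb (a := 2 * |deriv y t 0|) ?_ ?_
  · rw [map_add, hin, hout, PiLp.add_apply, PiLp.neg_apply, fold_apply_zero, fold_apply_zero,
      PiLp.neg_apply, abs_neg, neg_add_cancel]
  · rw [map_sub, hin, hout, sub_neg_eq_add, fold_add_fold_neg]

end Double

section Transform

variable {n : ℕ} [NeZero n] {M : Type*} [TopologicalSpace M]
  [ChartedSpace (EuclideanHalfSpace n) M] [IsManifold (𝓡∂ n) ∞ M]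
  {g : RMetric n M} {A : Set M} {φ : ℝ → Double n A} {L t : ℝ}

/-- The boundary of `A` in `M` is `C¹` and meets `∂M` orthogonally: at points of `∂M` the normals
of `∂M` are tangent to the zero set of a local defining function of `A`. -/
def HasOrthogonalBoundary (g : RMetric n M) (A : Set M) : Prop :=
  ∀ x ∈ frontier A, ∃ ρ : M → ℝ, IsDefiningFunctionAt (n := n) A ρ x ∧
    (x ∈ (𝓡∂ n).boundary M → ∀ ν : TangentSpace (𝓡∂ n) x,
      (∀ w, IsTangentToBoundary x w → g.inner x ν w = 0) → IsTangentToLevel ρ x ν)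

theorem HasOrthogonalBoundary.exists_isTangentToLevel (hA : HasOrthogonalBoundary g A)
    (hf : projCurve φ t ∈ frontier A) (hφ : IsC1At g φ t)
    (hl : MDifferentiableWithinAt 𝓘(ℝ, ℝ) (𝓡∂ n) (projCurve φ) (Iic t) t)
    (hr : MDifferentiableWithinAt 𝓘(ℝ, ℝ) (𝓡∂ n) (projCurve φ) (Ici t) t) :
    ∃ ρ : M → ℝ, IsDefiningFunctionAt (n := n) A ρ (projCurve φ t) ∧
      IsTangentToLevel (n := n) ρ (projCurve φ t) (velocity (projCurve φ) (Ici t) t) := by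
  obtain ⟨ρ, hρ, hnormal⟩ := hA _ hf
  have hcA : ∀ r, projCurve φ r ∈ A := fun r => (proj n A (φ r)).2
  refine ⟨ρ, hρ, hρ.mvfderiv_velocity_eq_zero hcA hl hr ?_⟩
  by_cases hb : projCurve φ t ∈ (𝓡∂ n).boundary M
  · rw [← sub_eq_zero, ← map_sub]
    exact hnormal hb _ (hφ.reflectionLaw hb hl hr).2
  · rw [hφ.velocity_Ici_eq_velocity_Iic hb]

theorem reflectionLaw_isTangentToLevel_self {ρ : M → ℝ} {x : M} {v : TangentSpace (𝓡∂ n) x}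
    (hv : IsTangentToLevel ρ x v) : ReflectionLaw g (IsTangentToLevel ρ x) v v := by
  change mvfderiv (𝓡∂ n) ρ x v = 0 at hv
  refine ⟨?_, fun w _ => by simp⟩
  change mvfderiv (𝓡∂ n) ρ x (v + v) = 0
  rw [map_add, hv, add_zero]

theorem IsDoubleGeodesic.isBrokenRay (hφ : IsDoubleGeodesic g A L φ)
    (hA : HasOrthogonalBoundary g A) : IsBrokenRay g A L (fun r => proj n A (φ r)) where
  pos := hφ.pos
  start_mem := hφ.start_mem
  end_mem := hφ.end_mem
  geodesic_right t ht := (hφ.geodesic_right t ht).imp fun _ h => ⟨h.1, h.2.1, h.2.2.2⟩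
  geodesic_left t ht := (hφ.geodesic_left t ht).imp fun _ h => ⟨h.1, h.2.1, h.2.2.2⟩
  reflection t ht := by
    obtain ⟨ε, hε, -, -, hleft⟩ := hφ.geodesic_left t ⟨ht.1, ht.2.le⟩
    obtain ⟨δ, hδ, -, -, hright⟩ := hφ.geodesic_right t ⟨ht.1.le, ht.2⟩
    have hl := hleft.mdifferentiableWithinAt_Iic hε
    have hr := hright.mdifferentiableWithinAt_Ici hδ
    have hc := hφ.c1 t ht
    refine ⟨velocity (projCurve φ) (Ici t) t, ?_, ?_⟩
    · split_ifs with hb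
      · exact hc.reflectionLaw hb hl hr
      · exact hc.velocity_Ici_eq_velocity_Iic hb
    · split_ifs with hf
      · obtain ⟨ρ, hρ, htangent⟩ := hA.exists_isTangentToLevel hf hc hl hr
        exact ⟨ρ, hρ, reflectionLaw_isTangentToLevel_self htangent⟩
      · rfl

/-- The map `Γ(Ã) → Γ_E(A)`, `φ ↦ π ∘ φ`. -/
def projRay (hA : HasOrthogonalBoundary g A) (γ : geodesics g A) : brokenRays g A :=
  ⟨(γ.1.1, fun r => proj n A (γ.1.2 r)), γ.2.isBrokenRay hA⟩

theorem geodesicRayTransform_reflect (hA : HasOrthogonalBoundary g A) (h f : A → ℝ) :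
    geodesicRayTransform g A (reflect n h) (reflect n f) =
      brokenRayTransform g A h f ∘ projRay hA :=
  rfl

end Transform

end BrokenRay

open BrokenRay in
theorem theorem4p5_general {n : ℕ} [NeZero n] {M : Type*} [TopologicalSpace M]
    [ChartedSpace (EuclideanHalfSpace n) M] [IsManifold (𝓡∂ n) ∞ M]
    (g : RMetric n M) (A : Set M) (hA : HasOrthogonalBoundary g A) (F H : Set (A → ℝ)) :
    (InjOn (fun p : (Double n A → ℝ) × (Double n A → ℝ) => geodesicRayTransform g A p.1 p.2)
        (reflectClass n H ×ˢ reflectClass n F) →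
      InjOn (fun p : (A → ℝ) × (A → ℝ) => brokenRayTransform g A p.1 p.2) (H ×ˢ F)) ∧
    (∀ h : A → ℝ,
      InjOn (fun f : Double n A → ℝ => geodesicRayTransform g A (reflect n h) f)
        (reflectClass n F) →
      InjOn (fun f : A → ℝ => brokenRayTransform g A h f) F) := by
  have hreflect := reflect_injective (n := n) (A := A)
  constructor
  · intro hinj
    refine InjOn.of_comp (g := (· ∘ projRay hA)) ?_
    exact hinj.comp (hreflect.prodMap hreflect).injOn fun p hp =>
      ⟨mem_image_of_mem _ hp.1, mem_image_of_mem _ hp.2⟩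
  · intro h hinj
    refine InjOn.of_comp (g := (· ∘ projRay hA)) ?_
    exact hinj.comp hreflect.injOn fun f hf => mem_image_of_mem _ hf


open BrokenRay in
theorem theorem4p5 {n : ℕ} [NeZero n] {M : Type*} [TopologicalSpace M] [T2Space M]
    [CompactSpace M] [ChartedSpace (EuclideanHalfSpace n) M] [IsManifold (𝓡∂ n) ∞ M]
    (g : RMetric n M) (A : Set M) (hA : IsReflectable g A) (F H : Set (A → ℝ)) :
    -- unknown attenuation
    (InjOn (fun p : (Double n A → ℝ) × (Double n A → ℝ) => geodesicRayTransform g A p.1 p.2)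
        (reflectClass n H ×ˢ reflectClass n F) →
      InjOn (fun p : (A → ℝ) × (A → ℝ) => brokenRayTransform g A p.1 p.2) (H ×ˢ F)) ∧
    -- known attenuation
    (∀ h ∈ H,
      InjOn (fun f : Double n A → ℝ => geodesicRayTransform g A (reflect n h) f)
        (reflectClass n F) →
      InjOn (fun f : A → ℝ => brokenRayTransform g A h f) F) := by
  obtain ⟨hunknown, hknown⟩ := theorem4p5_general g A hA.smooth_orthogonal F H
  exact ⟨hunknown, fun h _ => hknown h⟩
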